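/- All operators are bounded linear operators on complex Hilbert spaces. For a contraction $T$ on $\mathcal H$ put $D_T=(I-T^*T)^{1/2}$ and $\mathcal D_T=\overline{\mathrm{Ran}}(I-T^*T)$. Let $\mathbb E=\{(a_{11},a_{22},\det A): A=[a_{ij}]\in M_2(\mathbb C),\ \|A\|<1\}$. A commuting triple $(A,B,P)$ is an $\mathbb E$-contraction if $\overline{\mathbb E}$ is a spectral set for it, that is, its Taylor joint spectrum lies in $\overline{\mathbb E}$ and $\|f(A,B,P)\|\le\sup_{\overline{\mathbb E}}|f|$ for every rational function $f=p/q$ with $q$ zero-free on $\overline{\mathbb E}$. The fundamental operators of an $\mathbb E$-contraction $(A,B,P)$ are the unique operators $F_1,F_2\in\mathcal B(\mathcal D_P)$ with $A-B^*P=D_PF_1D_P$ and $B-A^*P=D_PF_2D_P$. For a Hilbert space $E$, $H^2(E)$ is the Hilbert space of functions $f(z)=\sum_{k\ge0}a_kz^k$ on the unit disc $\mathbb D$ with $a_k\in E$ and $\|f\|^2=\sum\|a_k\|^2<\infty$, and $T_\varphi$ denotes the Toeplitz operator (multiplication operator) on $H^2(E)$ with analytic symbol $\varphi:\mathbb D\to\mathcal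 B(E)$. Theorem (Berger--Coburn--Lebow). Let $V_1,\dots,V_n$ be commuting isometries on a Hilbert space $\mathcal H$ such that $V=\prod_{i=1}^nV_i$ is a pure isometry, i.e. $V^{*k}\to0$ strongly as $k\to\infty$. Then there exist (orthogonal) projections $P_1,\dots,P_n$ and unitaries $U_1,\dots,U_n$ in $\mathcal B(\mathcal D_{V^*})$ such that, with $P_i^\perp=I-P_i$, \[ (V_1,\dots,V_n,V)\equiv\left(T_{P_1^\perp U_1+zP_1U_1},\dots,T_{P_n^\perp U_n+zP_nU_n},T_z\right)\quad\text{on } H^2(\mathcal D_{V^*}), \] where $\equiv$ means that one and the same unitary $\mathcal H\to H^2(\mathcal D_{V^*})$ carries each operator on the left to the corresponding one on the right. Moreover, for each $i$, with $V_i'=\prod_{j\ne i}V_j$, the triple $(V_i^*,V_i'^*,V^*)$ is an $\mathbb E$-contraction, and $U_i^*P_i^\perp$, $P_iU_i$ are its (first and second) fundamental operators. -/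

import Mathlib

open scoped Topology
open Filter

noncomputable section

namespace TetrablockBCL

/-! ### The vector-valued Hardy space of the unit disc -/

section Hardy

variable (E : Type*) [NormedAddCommGroup E] [InnerProductSpace ℂ E] [CompleteSpace E]

variable {E} in
theorem summable_powerSeries (a : lp (fun _ : ℕ => E) 2) (z : Metric.ball (0 : ℂ) 1) :
    Summable (fun k : ℕ => (z : ℂ) ^ k • a k) := by
  have hz : ‖(z : ℂ)‖ < 1 := mem_ball_zero_iff.mp z.2
  refine Summable.of_norm_bounded
    ((summable_geometric_of_lt_one (norm_nonneg _) hz).mul_right ‖a‖) (fun k => ?_)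
  rw [norm_smul, norm_pow]
  exact mul_le_mul_of_nonneg_left (lp.norm_apply_le_norm (by norm_num) a k) (by positivity)

variable {E} in
/-- The function `z ↦ ∑ aₖ zᵏ` on the open unit disc, for a square-summable sequence `a`. -/
def powerSeriesFun : lp (fun _ : ℕ => E) 2 →ₗ[ℂ] (Metric.ball (0 : ℂ) 1 → E) where
  toFun a z := ∑' k : ℕ, (z : ℂ) ^ k • a k
  map_add' a b := by
    funext z
    simp only [lp.coeFn_add, Pi.add_apply, smul_add]
    exact (summable_powerSeries a z).tsum_add (summable_powerSeries b z)
  map_smul' c a := by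
    funext z
    simp only [lp.coeFn_smul, Pi.smul_apply, RingHom.id_apply]
    rw [← (summable_powerSeries a z).tsum_const_smul c]
    exact tsum_congr fun k => smul_comm _ _ _

theorem powerSeriesFun_injective : Function.Injective (powerSeriesFun (E := E)) := by
  rw [injective_iff_map_eq_zero]
  intro a ha
  let p : FormalMultilinearSeries ℂ ℂ E :=
    fun n => ContinuousMultilinearMap.mkPiRing ℂ (Fin n) (a n)
  have hp : HasFPowerSeriesAt (fun _ : ℂ => (0 : E)) p 0 := by
    rw [hasFPowerSeriesAt_iff]
    filter_upwards [Metric.ball_mem_nhds (0 : ℂ) one_pos] with z hz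
    have h1 := (summable_powerSeries a ⟨z, hz⟩).hasSum
    have h2 : ∑' k : ℕ, z ^ k • a k = 0 := congrFun ha ⟨z, hz⟩
    simp only at h1
    rw [h2] at h1
    simpa [p, FormalMultilinearSeries.coeff] using h1
  have h0 := hp.eq_zero
  ext n
  have h1 : p.coeff n = 0 := by rw [h0]; simp [FormalMultilinearSeries.coeff]
  simpa [p, FormalMultilinearSeries.coeff] using h1

/-- The Hardy space `H²(E)`: the functions `f : 𝔻 → E` of the form `f(z) = ∑ aₖ zᵏ`
with `∑ ‖aₖ‖² < ∞`. -/
def HardySpace : Type _ := ↥(LinearMap.range (powerSeriesFun (E := E)))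

instance : AddCommGroup (HardySpace E) :=
  inferInstanceAs (AddCommGroup ↥(LinearMap.range (powerSeriesFun (E := E))))

instance : Module ℂ (HardySpace E) :=
  inferInstanceAs (Module ℂ ↥(LinearMap.range (powerSeriesFun (E := E))))

instance : CoeFun (HardySpace E) (fun _ => Metric.ball (0 : ℂ) 1 → E) :=
  ⟨fun f => f.1⟩

/-- The sequence of Taylor coefficients at the origin of an element of `H²(E)`. -/
def HardySpace.taylor : HardySpace E ≃ₗ[ℂ] lp (fun _ : ℕ => E) 2 :=
  (LinearEquiv.ofInjective powerSeriesFun (powerSeriesFun_injective E)).symm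

variable {E} in
theorem HardySpace.hasSum_taylor (f : HardySpace E) (z : Metric.ball (0 : ℂ) 1) :
    HasSum (fun k : ℕ => (z : ℂ) ^ k • HardySpace.taylor E f k) (f z) := by
  have h : f = (HardySpace.taylor E).symm (HardySpace.taylor E f) := by simp
  have h2 : f z = ∑' k : ℕ, (z : ℂ) ^ k • HardySpace.taylor E f k := by
    conv_lhs => rw [h]
    rfl
  rw [h2]
  exact (summable_powerSeries _ z).hasSum

/-- The norm of `H²(E)`: `‖∑ aₖ zᵏ‖² = ∑ ‖aₖ‖²`. -/
instance : NormedAddCommGroup (HardySpace E) :=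
  NormedAddCommGroup.induced (HardySpace E) (lp (fun _ : ℕ => E) 2)
    (HardySpace.taylor E).toLinearMap (HardySpace.taylor E).injective

/-- The inner product of `H²(E)`: `⟪∑ aₖ zᵏ, ∑ bₖ zᵏ⟫ = ∑ ⟪aₖ, bₖ⟫`. -/
instance : InnerProductSpace ℂ (HardySpace E) where
  norm_smul_le c f := by
    change ‖HardySpace.taylor E (c • f)‖ ≤ ‖c‖ * ‖HardySpace.taylor E f‖
    rw [map_smul, norm_smul]
  inner f g := inner ℂ (HardySpace.taylor E f) (HardySpace.taylor E g)
  norm_sq_eq_re_inner f := norm_sq_eq_re_inner (𝕜 := ℂ) (HardySpace.taylor E f)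
  conj_inner_symm f g := inner_conj_symm (HardySpace.taylor E f) (HardySpace.taylor E g)
  add_left f g h := by rw [map_add, inner_add_left]
  smul_left f g c := by rw [map_smul, inner_smul_left]

variable {E} in
/-- `T` is the Toeplitz operator `T_φ` on `H²(E)` with analytic symbol `φ : 𝔻 → B(E)`,
i.e. multiplication by `φ`. -/
def IsAnalyticToeplitz (φ : ℂ → E →L[ℂ] E) (T : HardySpace E →L[ℂ] HardySpace E) : Prop :=
  ∀ (f : HardySpace E) (z : Metric.ball (0 : ℂ) 1), T f z = φ z (f z)

end Hardy

/-! ### Tetrablock contractions -/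

/-- The tetrablock `{(a₁₁, a₂₂, det A) : A ∈ M₂(ℂ), ‖A‖ < 1}`. -/
def tetrablock : Set (Fin 3 → ℂ) :=
  {x | ∃ M : Matrix (Fin 2) (Fin 2) ℂ,
    ‖Matrix.toEuclideanCLM (n := Fin 2) (𝕜 := ℂ) M‖ < 1 ∧ x = ![M 0 0, M 1 1, M.det]}

section Operators

variable {H : Type*} [NormedAddCommGroup H] [InnerProductSpace ℂ H]

/-- Exactness of the Koszul complex `0 → H → H³ → H³ → H → 0` of a triple of operators. -/
structure KoszulExact (A B C : H →L[ℂ] H) : Prop where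
  exact₀ : ∀ h, A h = 0 → B h = 0 → C h = 0 → h = 0
  exact₁ : ∀ a b c, A b - B a = 0 → A c - C a = 0 → B c - C b = 0 →
    ∃ h, a = A h ∧ b = B h ∧ c = C h
  exact₂ : ∀ x y z, A z - B y + C x = 0 →
    ∃ a b c, x = A b - B a ∧ y = A c - C a ∧ z = B c - C b
  exact₃ : ∀ h, ∃ x y z, A z - B y + C x = h

/-- The Taylor joint spectrum of a (commuting) triple of operators. -/
def taylorSpectrum (A B C : H →L[ℂ] H) : Set (Fin 3 → ℂ) :=
  {x | ¬ KoszulExact (A - x 0 • 1) (B - x 1 • 1) (C - x 2 • 1)}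

/-- The operator `p(A, B, C)`, for a polynomial `p` and commuting `A, B, C`. -/
def polyEval (p : MvPolynomial (Fin 3) ℂ) (A B C : H →L[ℂ] H) : H →L[ℂ] H :=
  ∑ m ∈ p.support, p.coeff m • (A ^ m 0 * B ^ m 1 * C ^ m 2)

/-- `(A, B, P)` is a commuting triple that has the closed tetrablock as a spectral set. -/
structure IsTetrablockContraction (A B P : H →L[ℂ] H) : Prop where
  commAB : Commute A B
  commAP : Commute A P
  commBP : Commute B P
  spectrum_subset : taylorSpectrum A B P ⊆ closure tetrablock
  isUnit : ∀ q : MvPolynomial (Fin 3) ℂ,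
    (∀ x ∈ closure tetrablock, MvPolynomial.eval x q ≠ 0) → IsUnit (polyEval q A B P)
  vonNeumann : ∀ p q : MvPolynomial (Fin 3) ℂ,
    (∀ x ∈ closure tetrablock, MvPolynomial.eval x q ≠ 0) →
    ‖polyEval p A B P * Ring.inverse (polyEval q A B P)‖ ≤
      ⨆ x : closure tetrablock, ‖MvPolynomial.eval x.1 p / MvPolynomial.eval x.1 q‖

variable [CompleteSpace H]

/-- `T*ⁿ → 0` strongly. -/
def IsPure (T : H →L[ℂ] H) : Prop :=
  ∀ h : H, Tendsto (fun k : ℕ => (ContinuousLinearMap.adjoint T ^ k) h) atTop (𝓝 0)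

/-- The defect operator `D_T = (I - T*T)^{1/2}` of a contraction. -/
def defectOp (T : H →L[ℂ] H) : H →L[ℂ] H :=
  CFC.sqrt (1 - ContinuousLinearMap.adjoint T * T)

/-- The defect space `𝒟_T`, the closure of the range of `I - T*T`. -/
abbrev defectSpace (T : H →L[ℂ] H) : Submodule ℂ H :=
  (LinearMap.range (1 - ContinuousLinearMap.adjoint T * T).toLinearMap).topologicalClosure

theorem defectOp_mem (T : H →L[ℂ] H) (h : H) : defectOp T h ∈ defectSpace T := by
  set S : H →L[ℂ] H := 1 - ContinuousLinearMap.adjoint T * T with hS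
  have hD : IsSelfAdjoint (defectOp T) := (CFC.sqrt_nonneg S).isSelfAdjoint
  have hsym : ∀ x y : H, inner ℂ (defectOp T x) y = inner ℂ x (defectOp T y) := by
    intro x y
    conv_lhs => rw [← hD.adjoint_eq]
    exact ContinuousLinearMap.adjoint_inner_left _ _ _
  by_cases hpos : 0 ≤ S
  · have hsq : ∀ x, defectOp T (defectOp T x) = S x := fun x => by
      have := CFC.sqrt_mul_sqrt_self S hpos
      exact congrArg (fun L : H →L[ℂ] H => L x) this
    unfold defectSpace
    rw [← Submodule.orthogonal_orthogonal_eq_closure, Submodule.mem_orthogonal]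
    intro y hy
    rw [Submodule.mem_orthogonal] at hy
    have h1 : inner ℂ (S y) y = 0 := hy _ ⟨y, rfl⟩
    rw [← hsq, hsym, inner_self_eq_zero] at h1
    rw [← hsym, h1, inner_zero_left]
  · have : defectOp T = 0 := by
      unfold defectOp CFC.sqrt
      exact cfcₙ_apply_of_not_predicate _ hpos
    rw [this]
    exact Submodule.zero_mem _

/-- The defect operator as a map from `H` into the defect space. -/
def defectMap (T : H →L[ℂ] H) : H →L[ℂ] defectSpace T :=
  (defectOp T).codRestrict (defectSpace T) (defectOp_mem T)

/-- The fundamental equations `A - B*P = D_P F₁ D_P` and `B - A*P = D_P F₂ D_P`. -/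
def FundamentalEquations (A B P : H →L[ℂ] H)
    (F₁ F₂ : defectSpace P →L[ℂ] defectSpace P) : Prop :=
  (A - ContinuousLinearMap.adjoint B * P =
      defectOp P ∘L (defectSpace P).subtypeL ∘L F₁ ∘L defectMap P) ∧
  (B - ContinuousLinearMap.adjoint A * P =
      defectOp P ∘L (defectSpace P).subtypeL ∘L F₂ ∘L defectMap P)

/-- `(A, B, P)` is a tetrablock contraction and `F₁, F₂` are its fundamental operators, the
unique solutions on `𝒟_P` of the fundamental equations. -/
structure AreFundamentalOperators (A B P : H →L[ℂ] H)
    (F₁ F₂ : defectSpace P →L[ℂ] defectSpace P) : Prop where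
  contraction : IsTetrablockContraction A B P
  equations : FundamentalEquations A B P F₁ F₂
  unique : ∀ G₁ G₂ : defectSpace P →L[ℂ] defectSpace P,
    FundamentalEquations A B P G₁ G₂ → G₁ = F₁ ∧ G₂ = F₂

/-- The linear isometry `W` of `H` onto `H²(E)` carries the operator `T` on `H` to the
Toeplitz operator with analytic symbol `φ`, i.e. `W T W* = T_φ`. -/
def IntertwinesToeplitz {E : Type*} [NormedAddCommGroup E] [InnerProductSpace ℂ E]
    [CompleteSpace E] (W : H ≃ₗᵢ[ℂ] HardySpace E) (T : H →L[ℂ] H) (φ : ℂ → E →L[ℂ] E) : Prop :=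
  IsAnalyticToeplitz φ
    ((W.toContinuousLinearEquiv : H →L[ℂ] HardySpace E) ∘L T ∘L
      (W.symm.toContinuousLinearEquiv : HardySpace E →L[ℂ] H))

end Operators

end TetrablockBCL

end

/-! Write `V = ST`, with `S` one of the isometries and `T` the product of the others. Everything
rests on the two splittings ker V* = ker T* ⊕ T ker S* = S ker T* ⊕ ker S*. The operator U = S(1 -
TT*) + T* carries the first onto the second summand by summand, so it is unitary on ker V*, and P =
1 - SS* projects onto ker S*. On ker V* this gives PU = T* and U*(1 - P) = S*. Since S* - TV* = S*(1
- VV*) and T* - SV* = T*(1 - VV*), these products solve the fundamental equations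
(`fundamentalEquations_bcl`). As V is pure, its Wold decomposition identifies h with the Taylor
coefficients (1 - VV*)V*ᵏh (`taylor_woldEquiv`), and V*S = T* turns S into a two-term convolution,
that is, into an affine symbol (`defectMap_adjoint_factor_apply`).

The spectral set property of (S*, T*, S*T*) needs a von Neumann inequality for rational functions.
Instead of a unitary extension, the pair S, T is nearly diagonalized by Fourier sums over pairs of
roots of unity (`discreteModel`). The model is exactly isometric, and the error in carrying S or T
to a multiplication is O(N^(-1/2)). Pointwise bounds on the torus thus pass to operator bounds in
the limit (`AsymptoticallyDiagonal.norm_le`), and the torus enters the closed tetrablock through (z,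
w) ↦ (z, w, zw). Invertibility of denominators comes from Gelfand theory (`isUnit_polyEval`), the
Taylor spectrum from explicit unit-ideal identities (`taylorSpectrum_mul_subset`). -/

namespace TetrablockBCL

/-! ### Commutative operator algebras and the polynomial calculus -/

section Algebra

variable {𝓐 : Type*} [NormedRing 𝓐] [NormedAlgebra ℂ 𝓐]

/-- The double centralizer works: since `s` lies in its own centralizer, an element commuting with
that centralizer also belongs to it, hence commutes with every other such element. -/
theorem exists_commutative_closed_subalgebra {s : Set 𝓐} (hs : ∀ x ∈ s, ∀ y ∈ s, Commute x y) :
    ∃ R : Subalgebra ℂ 𝓐, IsClosed (R : Set 𝓐) ∧ (∀ x y : R, x * y = y * x) ∧ s ⊆ R := by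
  refine ⟨Subalgebra.centralizer ℂ (Set.centralizer s), ?_, ?_, Set.subset_centralizer_centralizer⟩
  · rw [Subalgebra.coe_centralizer]
    exact Set.isClosed_centralizer _
  · rintro ⟨x, hx⟩ ⟨y, hy⟩
    refine Subtype.ext ?_
    rw [Subalgebra.mem_centralizer_iff] at hx hy
    have h1 : ∀ z ∈ s, z ∈ Set.centralizer s := fun z hz w hw => hs w hw z hz
    have h2 : x ∈ Set.centralizer s := fun z hz => hx z (h1 z hz)
    exact hy x h2

end Algebra

section Polynomials

open MvPolynomial

variable {H : Type*} [NormedAddCommGroup H] [InnerProductSpace ℂ H]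

/-- The inclusion of a commutative algebra carries evaluation of polynomials to `polyEval`. -/
theorem coe_aeval_eq_polyEval {R : Type*} [CommRing R] [Algebra ℂ R] (φ : R →ₐ[ℂ] (H →L[ℂ] H))
    (a b c : R) (p : MvPolynomial (Fin 3) ℂ) :
    φ (aeval ![a, b, c] p) = polyEval p (φ a) (φ b) (φ c) := by
  rw [aeval_def, eval₂_eq', polyEval, map_sum]
  refine Finset.sum_congr rfl fun m _ => ?_
  rw [Fin.prod_univ_three, ← Algebra.smul_def]
  simp

variable {A B C : H →L[ℂ] H}

theorem exists_algHom_polyEval (hAB : Commute A B) (hAC : Commute A C) (hBC : Commute B C) :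
    ∃ φ : MvPolynomial (Fin 3) ℂ →ₐ[ℂ] (H →L[ℂ] H), (∀ p, φ p = polyEval p A B C) ∧
      φ (X 0) = A ∧ φ (X 1) = B ∧ φ (X 2) = C := by
  obtain ⟨R, -, hR, hs⟩ := exists_commutative_closed_subalgebra (s := {A, B, C}) (by
    rintro x (rfl | rfl | rfl) y (rfl | rfl | rfl) <;>
      first | exact Commute.refl _ | assumption | (apply Commute.symm; assumption))
  let : CommRing R := { (inferInstance : Ring R) with mul_comm := hR }
  let a : R := ⟨A, hs (by simp)⟩
  let b : R := ⟨B, hs (by simp)⟩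
  let c : R := ⟨C, hs (by simp)⟩
  let ψ : R →ₐ[ℂ] (H →L[ℂ] H) := R.val
  refine ⟨ψ.comp (aeval ![a, b, c]), fun p => coe_aeval_eq_polyEval ψ a b c p, ?_, ?_, ?_⟩ <;>
    simp [ψ, a, b, c]

/-- In a closed commutative subalgebra, a non-unit is killed by some character χ. The point (χ A, χ
B, χ C) is then a zero of `q`, bounded by the norms and inheriting the relation `A * B = C` when it
holds. -/
theorem isUnit_polyEval [CompleteSpace H] (hAB : Commute A B) (hAC : Commute A C)
    (hBC : Commute B C) (q : MvPolynomial (Fin 3) ℂ)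
    (hq : ∀ x y z : ℂ, ‖x‖ ≤ ‖A‖ → ‖y‖ ≤ ‖B‖ → (A * B = C → x * y = z) →
      eval ![x, y, z] q ≠ 0) :
    IsUnit (polyEval q A B C) := by
  obtain h | h := subsingleton_or_nontrivial H
  · exact isUnit_of_subsingleton _
  obtain ⟨R, hcl, hR, hs⟩ := exists_commutative_closed_subalgebra (s := {A, B, C}) (by
    rintro x (rfl | rfl | rfl) y (rfl | rfl | rfl) <;>
      first | exact Commute.refl _ | assumption | (apply Commute.symm; assumption))
  let : NormedCommRing R := { (inferInstance : NormedRing R) with mul_comm := hR }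
  let : NormedAlgebra ℂ R := { (inferInstance : Algebra ℂ R) with
    norm_smul_le := fun c x => norm_smul_le c (x : H →L[ℂ] H) }
  have : CompleteSpace R := hcl.completeSpace_coe
  have : NormOneClass R := ⟨norm_one (α := H →L[ℂ] H)⟩
  let a : R := ⟨A, hs (by simp)⟩
  let b : R := ⟨B, hs (by simp)⟩
  let c : R := ⟨C, hs (by simp)⟩
  let ψ : R →ₐ[ℂ] (H →L[ℂ] H) := R.val
  have hψ : polyEval q A B C = ψ (aeval ![a, b, c] q) := (coe_aeval_eq_polyEval ψ a b c q).symm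
  rw [hψ]
  refine IsUnit.map ψ ?_
  by_contra hu
  obtain ⟨χ, hχ⟩ := WeakDual.CharacterSpace.exists_apply_eq_zero hu
  have hb : ∀ x : R, ‖χ x‖ ≤ ‖x‖ := fun x => by
    have := spectrum.norm_le_norm_of_mem (AlgHom.apply_mem_spectrum χ x)
    simpa using this
  refine hq (χ a) (χ b) (χ c) (hb a) (hb b) (fun h => ?_) ?_
  · rw [← map_mul]
    congr 1
    exact Subtype.ext h
  · rw [← hχ]
    have hc : χ (aeval ![a, b, c] q) = aeval (fun i => χ (![a, b, c] i)) q := by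
      rw [← AlgHom.coe_coe, ← MvPolynomial.comp_aeval_apply]
    rw [hc, ← MvPolynomial.coe_aeval_eq_eval]
    have : ![χ a, χ b, χ c] = fun i => χ (![a, b, c] i) := by
      funext i; fin_cases i <;> rfl
    rw [this]
    rfl

end Polynomials

/-! ### Exactness of Koszul complexes -/

section Koszul

variable {H : Type*} [NormedAddCommGroup H] [InnerProductSpace ℂ H]

/-- A triple generating the unit ideal of a commutative algebra of operators has an exact
Koszul complex. -/
theorem koszulExact_of_sum_eq_one {A B C X Y Z : H →L[ℂ] H}
    (h : X * A + Y * B + Z * C = 1)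
    (hXA : Commute X A) (hXB : Commute X B) (hXC : Commute X C)
    (hYA : Commute Y A) (hYB : Commute Y B) (hYC : Commute Y C)
    (hZA : Commute Z A) (hZB : Commute Z B) (hZC : Commute Z C) : KoszulExact A B C := by
  have h' : ∀ v, X (A v) + Y (B v) + Z (C v) = v := fun v => congrArg (fun L : H →L[ℂ] H => L v) h
  have cm : ∀ {S T : H →L[ℂ] H}, Commute S T → ∀ v, S (T v) = T (S v) := fun hc v =>
    congrArg (fun L : H →L[ℂ] H => L v) hc.eq
  refine ⟨fun v hA hB hC => ?_, fun a b c hab hac hbc => ?_, fun x y z hxyz => ?_, fun v => ?_⟩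
  · rw [← h' v, hA, hB, hC]; simp
  · have e1 : A b = B a := sub_eq_zero.mp hab
    have e2 : A c = C a := sub_eq_zero.mp hac
    have e3 : B c = C b := sub_eq_zero.mp hbc
    -- Contraction with (X, Y, Z) is a null-homotopy of the complex; the witnesses here and in the
    -- two remaining degrees are its values.
    refine ⟨X a + Y b + Z c, ?_, ?_, ?_⟩
    · rw [map_add, map_add, ← cm hXA, ← cm hYA, ← cm hZA, e1, e2, h']
    · rw [map_add, map_add, ← cm hXB, ← cm hYB, ← cm hZB, ← e1, e3, h']
    · rw [map_add, map_add, ← cm hXC, ← cm hYC, ← cm hZC, ← e2, ← e3, h']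
  · refine ⟨-(Y x) - Z y, X x - Z z, X y + Y z, ?_, ?_, ?_⟩
    · have e : Z (A z) - Z (B y) + Z (C x) = 0 := by rw [← map_sub, ← map_add, hxyz, map_zero]
      simp only [map_sub, map_neg, ← cm hXA, ← cm hZA, ← cm hYB, ← cm hZB]
      nth_rewrite 1 [← h' x]
      linear_combination (norm := module) e
    · have e : Y (A z) - Y (B y) + Y (C x) = 0 := by rw [← map_sub, ← map_add, hxyz, map_zero]
      simp only [map_add, map_sub, map_neg, ← cm hXA, ← cm hYA, ← cm hYC, ← cm hZC]
      nth_rewrite 1 [← h' y]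
      linear_combination (norm := module) -e
    · have e : X (A z) - X (B y) + X (C x) = 0 := by rw [← map_sub, ← map_add, hxyz, map_zero]
      simp only [map_add, map_sub, ← cm hXB, ← cm hYB, ← cm hXC, ← cm hZC]
      nth_rewrite 1 [← h' z]
      linear_combination (norm := module) e
  · refine ⟨Z v, -(Y v), X v, ?_⟩
    rw [map_neg, sub_neg_eq_add, ← cm hXA, ← cm hYB, ← cm hZC, h']

theorem koszulExact_of_isUnit {A B C : H →L[ℂ] H} (hAB : Commute A B) (hAC : Commute A C)
    (hA : IsUnit A) : KoszulExact A B C := by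
  obtain ⟨u, rfl⟩ := hA
  exact koszulExact_of_sum_eq_one (X := ↑u⁻¹) (Y := 0) (Z := 0) (by simp)
    (Commute.refl _).units_inv_left hAB.units_inv_left hAC.units_inv_left
    (.zero_left _) (.zero_left _) (.zero_left _) (.zero_left _) (.zero_left _) (.zero_left _)

end Koszul

/-! ### The closed tetrablock and the Taylor spectrum -/

section Tetrablock

open scoped Matrix.Norms.L2Operator in
theorem diagonal_mem_tetrablock {x y : ℂ} (hx : ‖x‖ < 1) (hy : ‖y‖ < 1) :
    ![x, y, x * y] ∈ tetrablock := by
  refine ⟨Matrix.diagonal ![x, y], ?_, by simp [Matrix.det_diagonal]⟩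
  rw [Matrix.l2_opNorm_toEuclideanCLM, Matrix.l2_opNorm_diagonal, pi_norm_lt_iff one_pos]
  intro i
  fin_cases i
  exacts [hx, hy]

theorem diagonal_mem_closure_tetrablock {x y : ℂ} (hx : ‖x‖ ≤ 1) (hy : ‖y‖ ≤ 1) :
    ![x, y, x * y] ∈ closure tetrablock := by
  -- Shrinking the diagonal matrix by a factor r < 1 lands in the open set; then r → 1.
  let f : ℝ → Fin 3 → ℂ := fun r => ![r * x, r * y, (r * x) * (r * y)]
  have hf : Continuous f := by
    refine continuous_pi fun i => ?_
    fin_cases i <;> simp [f] <;> fun_prop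
  have h1 : ![x, y, x * y] = f 1 := by simp [f]
  rw [h1]
  have h2 : (1 : ℝ) ∈ closure (Set.Ioo (0 : ℝ) 1) := by
    rw [closure_Ioo (by norm_num)]; simp
  refine map_mem_closure hf h2 fun r hr => diagonal_mem_tetrablock ?_ ?_ <;>
  · rw [norm_mul, Complex.norm_real, Real.norm_of_nonneg hr.1.le]
    nlinarith [hr.1, hr.2, norm_nonneg x, norm_nonneg y]

/-- Compactness makes the supremum in the spectral set inequality that of a bounded family; an
unbounded real `⨆` would take the default value 0. -/
theorem isCompact_closure_tetrablock : IsCompact (closure tetrablock) := by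
  refine Bornology.IsBounded.isCompact_closure ?_
  rw [isBounded_iff_forall_norm_le]
  refine ⟨2, ?_⟩
  rintro _ ⟨M, hM, rfl⟩
  have hent : ∀ i j, ‖M i j‖ ≤ 1 := fun i j => by
    have h1 := (Matrix.toEuclideanCLM (n := Fin 2) (𝕜 := ℂ) M).le_opNorm
      (EuclideanSpace.single j 1)
    have h2 := PiLp.norm_apply_le (Matrix.toEuclideanCLM (n := Fin 2) (𝕜 := ℂ) M
      (EuclideanSpace.single j 1)) i
    rw [PiLp.norm_single, norm_one, mul_one] at h1
    have h3 : (Matrix.toEuclideanCLM (n := Fin 2) (𝕜 := ℂ) M (EuclideanSpace.single j 1)) i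
        = M i j := by
      change (Matrix.mulVec M (Pi.single j 1)) i = M i j
      simp
    rw [h3] at h2
    linarith
  refine (pi_norm_le_iff_of_nonneg (by norm_num)).mpr fun i => ?_
  fin_cases i
  · exact (hent 0 0).trans (by norm_num)
  · exact (hent 1 1).trans (by norm_num)
  · change ‖M.det‖ ≤ 2
    rw [Matrix.det_fin_two]
    refine (norm_sub_le _ _).trans ?_
    rw [norm_mul, norm_mul]
    have := mul_le_one₀ (hent 0 0) (norm_nonneg _) (hent 1 1)
    have := mul_le_one₀ (hent 0 1) (norm_nonneg _) (hent 1 0)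
    linarith

theorem norm_eval_le_iSup (p q : MvPolynomial (Fin 3) ℂ)
    (hq : ∀ x ∈ closure tetrablock, MvPolynomial.eval x q ≠ 0) {x : Fin 3 → ℂ}
    (hx : x ∈ closure tetrablock) :
    ‖MvPolynomial.eval x p‖ ≤ (⨆ x : closure tetrablock,
      ‖MvPolynomial.eval x.1 p / MvPolynomial.eval x.1 q‖) * ‖MvPolynomial.eval x q‖ := by
  rw [← div_le_iff₀ (norm_pos_iff.mpr (hq x hx)), ← norm_div]
  refine le_ciSup (f := fun x : closure tetrablock =>
    ‖MvPolynomial.eval x.1 p / MvPolynomial.eval x.1 q‖) ?_ ⟨x, hx⟩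
  have : CompactSpace (closure tetrablock) :=
    isCompact_iff_compactSpace.mp isCompact_closure_tetrablock
  refine (isCompact_range ?_).bddAbove
  refine Continuous.norm (Continuous.div ?_ ?_ fun x => hq x.1 x.2)
  · exact (MvPolynomial.continuous_eval p).comp continuous_subtype_val
  · exact (MvPolynomial.continuous_eval q).comp continuous_subtype_val

end Tetrablock

section Spectrum

variable {H : Type*} [NormedAddCommGroup H] [InnerProductSpace ℂ H] [CompleteSpace H]

theorem isUnit_sub_smul_of_norm_lt {A : H →L[ℂ] H} (hA : ‖A‖ ≤ 1) {c : ℂ} (hc : 1 < ‖c‖) :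
    IsUnit (A - c • 1) := by
  obtain h | h := subsingleton_or_nontrivial H
  · exact isUnit_of_subsingleton _
  by_contra hu
  have h1 : c ∈ spectrum ℂ A := by
    rw [spectrum.mem_iff, Algebra.algebraMap_eq_smul_one]
    rwa [← IsUnit.neg_iff, neg_sub]
  have := spectrum.norm_le_norm_of_mem h1
  linarith

/-- Off the closed tetrablock, either a coordinate x₀ or x₁ exceeds 1 in modulus and the
corresponding shifted operator is invertible, or x₂ ≠ x₀x₁ and the relation between the three
operators is violated by a nonzero scalar. -/
theorem taylorSpectrum_mul_subset {A B : H →L[ℂ] H} (hAB : Commute A B)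
    (hA : ‖A‖ ≤ 1) (hB : ‖B‖ ≤ 1) :
    taylorSpectrum A B (A * B) ⊆ closure tetrablock := by
  intro x hx
  have cA : ∀ (T : H →L[ℂ] H) (c : ℂ), Commute T (c • 1) := fun T c =>
    (Commute.one_right T).smul_right c
  have hAC : Commute A (A * B) := (Commute.refl A).mul_right hAB
  have hBC : Commute B (A * B) := hAB.symm.mul_right (Commute.refl B)
  have shift : ∀ {S T : H →L[ℂ] H} (_ : Commute S T) (c d : ℂ), Commute (S - c • 1) (T - d • 1) :=
    fun h c d => ((h.sub_right (cA _ d)).sub_left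
      (((cA _ c).symm).sub_right (cA _ d)))
  by_contra hcl
  apply hx
  by_cases h3 : x 2 = x 0 * x 1
  · have hx' : x = ![x 0, x 1, x 0 * x 1] := by
      funext i; fin_cases i <;> simp [h3]
    have h01 : 1 < ‖x 0‖ ∨ 1 < ‖x 1‖ := by
      by_contra! hc
      exact hcl (hx' ▸ diagonal_mem_closure_tetrablock hc.1 hc.2)
    rcases h01 with h0 | h1
    · exact koszulExact_of_isUnit (shift hAB _ _) (shift hAC _ _)
        (isUnit_sub_smul_of_norm_lt hA h0)
    · obtain ⟨u, hu⟩ := isUnit_sub_smul_of_norm_lt hB h1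
      have key : ∀ T : H →L[ℂ] H, Commute B T → ∀ c : ℂ, Commute (↑u⁻¹ : H →L[ℂ] H) (T - c • 1) :=
        fun T h c => Commute.units_inv_left (by rw [hu]; exact shift h _ _)
      refine koszulExact_of_sum_eq_one (X := 0) (Y := ↑u⁻¹) (Z := 0) ?_
        (.zero_left _) (.zero_left _) (.zero_left _) (key _ hAB.symm _) (key _ (.refl _) _)
        (key _ hBC _) (.zero_left _) (.zero_left _) (.zero_left _)
      rw [← hu]; simp
  · have hd : x 0 * x 1 - x 2 ≠ 0 := sub_ne_zero.mpr (Ne.symm h3)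
    set d := (x 0 * x 1 - x 2)⁻¹ with hd'
    have hone : ∀ (T S : H →L[ℂ] H) (c : ℂ), Commute T S → Commute T (S - c • 1) :=
      fun T S c h => h.sub_right (cA _ _)
    -- The coefficients come from -B(A - x₀) - x₀(B - x₁) + (AB - x₂) = x₀x₁ - x₂, divided by the
    -- right side.
    refine koszulExact_of_sum_eq_one (X := -(d • B)) (Y := -((d * x 0) • 1)) (Z := d • 1) ?_
      ((hone _ _ _ hAB.symm).smul_left _).neg_left ((hone _ _ _ (.refl _)).smul_left _).neg_left
      ((hone _ _ _ hBC).smul_left _).neg_left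
      (cA _ _).symm.neg_left (cA _ _).symm.neg_left (cA _ _).symm.neg_left
      (cA _ _).symm (cA _ _).symm (cA _ _).symm
    have h1 : d * (x 0 * x 1 - x 2) = 1 := inv_mul_cancel₀ hd
    have h2 : -(d • B) * (A - x 0 • 1) + -((d * x 0) • 1) * (B - x 1 • 1) +
        d • 1 * (A * B - x 2 • 1) = (d * (x 0 * x 1 - x 2)) • (1 : H →L[ℂ] H) := by
      have e : B * A = A * B := hAB.eq.symm
      simp only [mul_sub, neg_mul, smul_mul_assoc, one_mul, mul_smul_comm, mul_one, e]
      module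
    rw [h2, h1, one_smul]

end Spectrum

/-! ### The discrete Fourier transform -/

section RootsOfUnity

/-- The `j`-th power of the standard primitive root of unity of order `N + 1`. -/
noncomputable def rootOfUnity (N : ℕ) (j : Fin (N + 1)) : ℂ :=
  Complex.exp (2 * Real.pi * Complex.I / (N + 1 : ℕ)) ^ (j : ℕ)

theorem isPrimitiveRoot_exp_succ (N : ℕ) :
    IsPrimitiveRoot (Complex.exp (2 * Real.pi * Complex.I / (N + 1 : ℕ))) (N + 1) :=
  Complex.isPrimitiveRoot_exp _ N.succ_ne_zero

theorem rootOfUnity_pow (N : ℕ) (j : Fin (N + 1)) : rootOfUnity N j ^ (N + 1) = 1 := by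
  rw [rootOfUnity, ← pow_mul, mul_comm (j : ℕ), pow_mul, (isPrimitiveRoot_exp_succ N).pow_eq_one, one_pow]

theorem norm_rootOfUnity (N : ℕ) (j : Fin (N + 1)) : ‖rootOfUnity N j‖ = 1 := by
  rw [rootOfUnity, norm_pow, (isPrimitiveRoot_exp_succ N).norm'_eq_one N.succ_ne_zero, one_pow]

theorem sum_star_rootOfUnity_pow_mul (N : ℕ) (a b : Fin (N + 1)) :
    ∑ j, star (rootOfUnity N j ^ (a : ℕ)) * rootOfUnity N j ^ (b : ℕ) =
      if a = b then (N + 1 : ℂ) else 0 := by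
  have hroot := isPrimitiveRoot_exp_succ N
  set ω := Complex.exp (2 * Real.pi * Complex.I / (N + 1 : ℕ)) with hω
  -- The sum over j is geometric with ratio `r`, an (N+1)-st root of unity equal to 1 only for a =
  -- b.
  set r : ℂ := star (ω ^ (a : ℕ)) * ω ^ (b : ℕ) with hr
  have h1 : ∀ j : Fin (N + 1), star (rootOfUnity N j ^ (a : ℕ)) * rootOfUnity N j ^ (b : ℕ) =
      r ^ (j : ℕ) := fun j => by
    rw [rootOfUnity, ← hω, hr, mul_pow, star_pow, star_pow, star_pow]
    simp only [← pow_mul, mul_comm]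
  simp only [h1]
  have hnorm : ‖ω‖ = 1 := hroot.norm'_eq_one N.succ_ne_zero
  have hinv : star (ω ^ (a : ℕ)) * ω ^ (a : ℕ) = 1 := by
    rw [← starRingEnd_apply, Complex.conj_mul', norm_pow, hnorm]
    simp
  split_ifs with hab
  · subst hab
    rw [hr, hinv]
    simp
  · have hne : r ≠ 1 := by
      intro h
      apply hab
      have h2 : ω ^ (a : ℕ) = ω ^ (b : ℕ) := by
        refine mul_left_cancel₀ (left_ne_zero_of_mul_eq_one hinv) ?_
        rw [hinv, ← h]
      exact Fin.ext (hroot.pow_inj a.2 b.2 h2)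
    have hpow : r ^ (N + 1) = 1 := by
      rw [hr, mul_pow, ← star_pow, ← pow_mul, ← pow_mul, mul_comm (a : ℕ), mul_comm (b : ℕ),
        pow_mul, pow_mul, hroot.pow_eq_one, one_pow, one_pow, star_one, one_mul]
    rw [Fin.sum_univ_eq_sum_range (fun j => r ^ j), geom_sum_eq hne, hpow, sub_self, zero_div]

variable {H : Type*} [NormedAddCommGroup H] [InnerProductSpace ℂ H]

/-- Parseval's identity for the discrete Fourier transform. -/
theorem sum_norm_sq_sum_rootOfUnity (N : ℕ) (x : Fin (N + 1) → H) :
    ∑ j, ‖∑ a : Fin (N + 1), rootOfUnity N j ^ (a : ℕ) • x a‖ ^ 2 = (N + 1) * ∑ a, ‖x a‖ ^ 2 := by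
  have key : ∑ j, inner ℂ (∑ a : Fin (N + 1), rootOfUnity N j ^ (a : ℕ) • x a)
      (∑ a : Fin (N + 1), rootOfUnity N j ^ (a : ℕ) • x a) = (N + 1) * ∑ a, inner ℂ (x a) (x a) := by
    simp only [sum_inner, inner_sum, inner_smul_left, inner_smul_right, starRingEnd_apply, Finset.mul_sum]
    rw [Finset.sum_comm]
    refine Finset.sum_congr rfl fun a _ => ?_
    rw [Finset.sum_comm]
    have : ∀ b : Fin (N + 1), ∑ j, rootOfUnity N j ^ (a : ℕ) * (star (rootOfUnity N j ^ (b : ℕ)) *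
        inner ℂ (x b) (x a)) = (if b = a then (N + 1 : ℂ) else 0) * inner ℂ (x b) (x a) := by
      intro b
      rw [← sum_star_rootOfUnity_pow_mul, Finset.sum_mul]
      simp only [mul_assoc, mul_left_comm]
    simp only [this, ite_mul, zero_mul, Finset.sum_ite_eq', Finset.mem_univ, if_true]
  simp only [inner_self_eq_norm_sq_to_K] at key
  exact Complex.ofReal_injective (by push_cast; exact key)

end RootsOfUnity

/-! ### Approximate diagonalization of two commuting isometries -/

section DiscreteModel

variable {H : Type*} [NormedAddCommGroup H] [InnerProductSpace ℂ H]

/-- The operator of multiplication by a scalar function on a finite `ℓ²` space. -/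
noncomputable def diagMul {ι : Type*} [Fintype ι] (u : ι → ℂ) (x : PiLp 2 (fun _ : ι => H)) :
    PiLp 2 (fun _ : ι => H) :=
  WithLp.toLp 2 fun i => u i • x i

theorem norm_diagMul_le {ι : Type*} [Fintype ι] {u v : ι → ℂ} {M : ℝ}
    (h : ∀ i, ‖u i‖ ≤ M * ‖v i‖) (hM : 0 ≤ M) (x : PiLp 2 (fun _ : ι => H)) :
    ‖diagMul u x‖ ≤ M * ‖diagMul v x‖ := by
  refine le_of_sq_le_sq ?_ (by positivity)
  rw [mul_pow, PiLp.norm_sq_eq_of_L2, PiLp.norm_sq_eq_of_L2, Finset.mul_sum]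
  refine Finset.sum_le_sum fun i _ => ?_
  rw [← mul_pow]
  refine pow_le_pow_left₀ (norm_nonneg _) ?_ 2
  change ‖u i • x i‖ ≤ M * ‖v i • x i‖
  rw [norm_smul, norm_smul, ← mul_assoc]
  exact mul_le_mul_of_nonneg_right (h i) (norm_nonneg _)

theorem norm_diagMul_le_of_le {ι : Type*} [Fintype ι] {u : ι → ℂ} {M : ℝ}
    (h : ∀ i, ‖u i‖ ≤ M) (hM : 0 ≤ M) (x : PiLp 2 (fun _ : ι => H)) :
    ‖diagMul u x‖ ≤ M * ‖x‖ := by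
  have h1 : diagMul (fun _ => 1) x = x := by
    ext i
    simp [diagMul]
  have := norm_diagMul_le (v := fun _ => 1) (by simpa using h) hM x
  rwa [h1] at this

/-- The discrete Fourier sum `∑ zʲ Sʲ` at a root of unity `z`. -/
noncomputable def rootSum (S : H →L[ℂ] H) (N : ℕ) (j : Fin (N + 1)) : H →L[ℂ] H :=
  ∑ a : Fin (N + 1), rootOfUnity N j ^ (a : ℕ) • S ^ (a : ℕ)

theorem norm_pow_apply_of_isometry {S : H →L[ℂ] H} (hS : Isometry S) (a : ℕ) (h : H) :
    ‖(S ^ a) h‖ = ‖h‖ := by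
  induction a with
  | zero => simp
  | succ a ih =>
    rw [pow_succ', mul_apply_eq_comp, (AddMonoidHomClass.isometry_iff_norm S).mp hS, ih]

theorem norm_le_one_of_isometry {S : H →L[ℂ] H} (hS : Isometry S) : ‖S‖ ≤ 1 :=
  S.opNorm_le_bound zero_le_one fun x => by
    rw [(AddMonoidHomClass.isometry_iff_norm S).mp hS, one_mul]

theorem sum_norm_sq_rootSum {S : H →L[ℂ] H} (hS : Isometry S) (N : ℕ) (h : H) :
    ∑ j, ‖rootSum S N j h‖ ^ 2 = (N + 1) ^ 2 * ‖h‖ ^ 2 := by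
  have := sum_norm_sq_sum_rootOfUnity N fun a => (S ^ (a : ℕ)) h
  simp only [norm_pow_apply_of_isometry hS, Finset.sum_const, Finset.card_univ, Fintype.card_fin,
    nsmul_eq_mul] at this
  simp only [rootSum, sum_apply, smul_apply, this]
  push_cast
  ring

theorem commute_rootSum_right {S T : H →L[ℂ] H} (h : Commute S T) (N : ℕ) (j : Fin (N + 1)) :
    Commute S (rootSum T N j) :=
  Commute.sum_right _ _ _ fun _ _ => (h.pow_right _).smul_right _

theorem commute_rootSum {S T : H →L[ℂ] H} (h : Commute S T) (N : ℕ) (j k : Fin (N + 1)) :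
    Commute (rootSum S N j) (rootSum T N k) :=
  (commute_rootSum_right (commute_rootSum_right h N k).symm N j).symm

/-- Multiplying by S shifts the Fourier sum by one index, so the difference telescopes to its two
end terms, where zᴺ⁺¹ = 1. -/
theorem star_rootOfUnity_smul_rootSum_sub (S : H →L[ℂ] H) (N : ℕ) (j : Fin (N + 1)) :
    star (rootOfUnity N j) • rootSum S N j - rootSum S N j * S =
      star (rootOfUnity N j) • (1 - S ^ (N + 1)) := by
  have hz : star (rootOfUnity N j) * rootOfUnity N j = 1 := by
    rw [← starRingEnd_apply, Complex.conj_mul', norm_rootOfUnity]; simp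
  have h1 : rootSum S N j * S = star (rootOfUnity N j) •
      ∑ a : Fin (N + 1), rootOfUnity N j ^ ((a : ℕ) + 1) • S ^ ((a : ℕ) + 1) := by
    rw [rootSum, Finset.sum_mul, Finset.smul_sum]
    refine Finset.sum_congr rfl fun a _ => ?_
    rw [smul_mul_assoc, ← pow_succ, smul_smul, pow_succ' (rootOfUnity N j), ← mul_assoc, hz, one_mul]
  rw [h1, ← smul_sub, rootSum,
    Fin.sum_univ_eq_sum_range (fun a => rootOfUnity N j ^ a • S ^ a),
    Fin.sum_univ_eq_sum_range (fun a => rootOfUnity N j ^ (a + 1) • S ^ (a + 1)),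
    ← Finset.sum_sub_distrib, Finset.sum_range_sub' (fun a => rootOfUnity N j ^ a • S ^ a),
    rootOfUnity_pow]
  simp

theorem norm_rootSum_defect_le {S : H →L[ℂ] H} (hS : Isometry S) (N : ℕ) (j : Fin (N + 1)) (h : H) :
    ‖star (rootOfUnity N j) • rootSum S N j h - rootSum S N j (S h)‖ ≤ 2 * ‖h‖ := by
  have h1 := congrArg (fun L : H →L[ℂ] H => L h) (star_rootOfUnity_smul_rootSum_sub S N j)
  simp only [sub_apply, _root_.smul_apply,
    mul_apply_eq_comp, one_apply_eq_self] at h1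
  rw [h1, norm_smul, norm_star, norm_rootOfUnity, one_mul]
  refine (norm_sub_le _ _).trans ?_
  rw [norm_pow_apply_of_isometry hS, two_mul]

/-- The approximate embedding of `H` in the `H`-valued functions on pairs of roots of unity,
which nearly diagonalizes the pair `S, T`. -/
noncomputable def discreteModel (S T : H →L[ℂ] H) (N : ℕ) (h : H) :
    PiLp 2 (fun _ : Fin (N + 1) × Fin (N + 1) => H) :=
  WithLp.toLp 2 fun i => ((N + 1 : ℂ) ^ 2)⁻¹ • rootSum S N i.1 (rootSum T N i.2 h)

theorem discreteModel_add (S T : H →L[ℂ] H) (N : ℕ) (h k : H) :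
    discreteModel S T N (h + k) = discreteModel S T N h + discreteModel S T N k := by
  ext i
  simp [discreteModel]

theorem discreteModel_smul (S T : H →L[ℂ] H) (N : ℕ) (c : ℂ) (h : H) :
    discreteModel S T N (c • h) = c • discreteModel S T N h := by
  ext i
  simp [discreteModel, smul_comm c]

variable {S T : H →L[ℂ] H}

theorem norm_sq_smul_inv_succ_sq (N : ℕ) (h : H) :
    ‖((N + 1 : ℂ) ^ 2)⁻¹ • h‖ ^ 2 = ((N + 1 : ℝ) ^ 4)⁻¹ * ‖h‖ ^ 2 := by
  rw [norm_smul, mul_pow, norm_inv, norm_pow]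
  have : ‖(N + 1 : ℂ)‖ = N + 1 := by
    have := Complex.norm_natCast (N + 1)
    push_cast at this
    exact this
  rw [this, inv_pow, ← pow_mul]

/-- Parseval in each variable contributes (N+1)², as all N+1 vectors Sᵃh have the norm of h; the
normalization cancels the product (N+1)⁴. -/
theorem norm_discreteModel (hS : Isometry S) (hT : Isometry T) (N : ℕ) (h : H) :
    ‖discreteModel S T N h‖ = ‖h‖ := by
  refine (pow_left_inj₀ (norm_nonneg _) (norm_nonneg _) two_ne_zero).mp ?_
  rw [PiLp.norm_sq_eq_of_L2]
  simp only [discreteModel, norm_sq_smul_inv_succ_sq]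
  rw [← Finset.mul_sum, Fintype.sum_prod_type_right]
  simp only [sum_norm_sq_rootSum hS]
  rw [← Finset.mul_sum, sum_norm_sq_rootSum hT]
  field_simp

theorem tendsto_zero_of_sq_le {e : ℕ → ℝ} (he : ∀ N, 0 ≤ e N) {C : ℝ}
    (h : ∀ N, e N ^ 2 ≤ C * (1 / ((N : ℝ) + 1))) : Tendsto e atTop (𝓝 0) := by
  have h1 : Tendsto (fun N => e N ^ 2) atTop (𝓝 0) := by
    refine squeeze_zero (fun N => sq_nonneg _) h ?_
    simpa using tendsto_one_div_add_atTop_nhds_zero_nat.const_mul C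
  have h2 := (Real.continuous_sqrt.tendsto 0).comp h1
  simpa [Function.comp_def, Real.sqrt_sq (he _)] using h2

/-- In the first variable only the two end terms survive, with squared norm at most 4‖·‖² at each of
N+1 roots, against the (N+1)² of the full Parseval sum; the quotient is 4/(N+1). -/
theorem sq_norm_discreteModel_defect_fst_le (hS : Isometry S) (hT : Isometry T)
    (hST : Commute S T) (N : ℕ) (h : H) :
    ‖diagMul (fun i => star (rootOfUnity N i.1)) (discreteModel S T N h) -
      discreteModel S T N (S h)‖ ^ 2 ≤ (4 * ‖h‖ ^ 2) * (1 / ((N : ℝ) + 1)) := by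
  rw [PiLp.norm_sq_eq_of_L2]
  have h1 : ∀ i : Fin (N + 1) × Fin (N + 1),
      ‖(diagMul (fun i => star (rootOfUnity N i.1)) (discreteModel S T N h) -
        discreteModel S T N (S h)) i‖ ^ 2 ≤
      ((N + 1 : ℝ) ^ 4)⁻¹ * (4 * ‖rootSum T N i.2 h‖ ^ 2) := by
    intro i
    have hc : rootSum T N i.2 (S h) = S (rootSum T N i.2 h) :=
      (congrArg (fun L : H →L[ℂ] H => L h) (commute_rootSum_right hST N i.2).eq).symm
    have e : (diagMul (fun i => star (rootOfUnity N i.1)) (discreteModel S T N h) -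
        discreteModel S T N (S h)) i = ((N + 1 : ℂ) ^ 2)⁻¹ •
        (star (rootOfUnity N i.1) • rootSum S N i.1 (rootSum T N i.2 h) -
          rootSum S N i.1 (S (rootSum T N i.2 h))) := by
      change star (rootOfUnity N i.1) • ((N + 1 : ℂ) ^ 2)⁻¹ • rootSum S N i.1 (rootSum T N i.2 h) -
        ((N + 1 : ℂ) ^ 2)⁻¹ • rootSum S N i.1 (rootSum T N i.2 (S h)) = _
      rw [hc, smul_sub, smul_comm]
    rw [e, norm_sq_smul_inv_succ_sq]
    refine mul_le_mul_of_nonneg_left ?_ (by positivity)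
    refine (pow_le_pow_left₀ (norm_nonneg _) (norm_rootSum_defect_le hS N i.1 _) 2).trans ?_
    rw [mul_pow]; norm_num
  refine (Finset.sum_le_sum fun i _ => h1 i).trans ?_
  rw [← Finset.mul_sum, ← Finset.mul_sum, Fintype.sum_prod_type]
  simp only [sum_norm_sq_rootSum hT, Finset.sum_const, Finset.card_univ, Fintype.card_fin,
    nsmul_eq_mul]
  refine le_of_eq ?_
  push_cast
  field_simp

theorem sq_norm_discreteModel_defect_snd_le (hS : Isometry S) (hT : Isometry T)
    (hST : Commute S T) (N : ℕ) (h : H) :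
    ‖diagMul (fun i => star (rootOfUnity N i.2)) (discreteModel S T N h) -
      discreteModel S T N (T h)‖ ^ 2 ≤ (4 * ‖h‖ ^ 2) * (1 / ((N : ℝ) + 1)) := by
  refine le_trans (le_of_eq ?_) (sq_norm_discreteModel_defect_fst_le hT hS hST.symm N h)
  have hc : ∀ j k v, rootSum S N j (rootSum T N k v) = rootSum T N k (rootSum S N j v) :=
    fun j k v => congrArg (fun L : H →L[ℂ] H => L v) (commute_rootSum hST N j k).eq
  rw [PiLp.norm_sq_eq_of_L2, PiLp.norm_sq_eq_of_L2, Fintype.sum_prod_type,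
    Fintype.sum_prod_type_right]
  simp only [diagMul, discreteModel, PiLp.sub_apply, hc]

/-- The operator `R` is asymptotically carried to multiplication by the functions `u N`. -/
def AsymptoticallyDiagonal (S T : H →L[ℂ] H) (u : ∀ N : ℕ, Fin (N + 1) × Fin (N + 1) → ℂ)
    (R : H →L[ℂ] H) : Prop :=
  (∃ C : ℝ, 0 ≤ C ∧ ∀ N i, ‖u N i‖ ≤ C) ∧ ∀ h, Tendsto
    (fun N => ‖diagMul (u N) (discreteModel S T N h) - discreteModel S T N (R h)‖) atTop (𝓝 0)

variable {u v : ∀ N : ℕ, Fin (N + 1) × Fin (N + 1) → ℂ} {Q R : H →L[ℂ] H}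

theorem asymptoticallyDiagonal_fst (hS : Isometry S) (hT : Isometry T) (hST : Commute S T) :
    AsymptoticallyDiagonal S T (fun N i => star (rootOfUnity N i.1)) S :=
  ⟨⟨1, zero_le_one, fun N i => by rw [norm_star, norm_rootOfUnity]⟩, fun h =>
    tendsto_zero_of_sq_le (fun _ => norm_nonneg _)
      fun N => sq_norm_discreteModel_defect_fst_le hS hT hST N h⟩

theorem asymptoticallyDiagonal_snd (hS : Isometry S) (hT : Isometry T) (hST : Commute S T) :
    AsymptoticallyDiagonal S T (fun N i => star (rootOfUnity N i.2)) T :=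
  ⟨⟨1, zero_le_one, fun N i => by rw [norm_star, norm_rootOfUnity]⟩, fun h =>
    tendsto_zero_of_sq_le (fun _ => norm_nonneg _)
      fun N => sq_norm_discreteModel_defect_snd_le hS hT hST N h⟩

theorem asymptoticallyDiagonal_const (c : ℂ) :
    AsymptoticallyDiagonal S T (fun _ _ => c) (c • 1) := by
  refine ⟨⟨‖c‖, norm_nonneg _, fun _ _ => le_rfl⟩, fun h => ?_⟩
  have : ∀ N, diagMul (fun _ => c) (discreteModel S T N h) =
      discreteModel S T N ((c • (1 : H →L[ℂ] H)) h) := fun N => by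
    rw [smul_apply, one_apply_eq_self, discreteModel_smul]
    rfl
  simp [this]

theorem AsymptoticallyDiagonal.add (hu : AsymptoticallyDiagonal S T u Q)
    (hv : AsymptoticallyDiagonal S T v R) :
    AsymptoticallyDiagonal S T (fun N i => u N i + v N i) (Q + R) := by
  obtain ⟨⟨C, hC, hC'⟩, hu⟩ := hu
  obtain ⟨⟨D, hD, hD'⟩, hv⟩ := hv
  refine ⟨⟨C + D, by positivity, fun N i => norm_add_le_of_le (hC' N i) (hD' N i)⟩, fun h => ?_⟩
  refine squeeze_zero (fun _ => norm_nonneg _) (fun N => ?_) (by simpa using (hu h).add (hv h))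
  refine le_trans (le_of_eq ?_) (norm_add_le _ _)
  congr 1
  ext i
  simp only [diagMul, add_apply, discreteModel_add, PiLp.sub_apply,
    PiLp.add_apply]
  module

/-- With J the model map, uvJh - JQRh = u(vJh - JRh) + (uJRh - JQRh); the uniform bound on `u`
controls the first term. -/
theorem AsymptoticallyDiagonal.mul (hu : AsymptoticallyDiagonal S T u Q)
    (hv : AsymptoticallyDiagonal S T v R) :
    AsymptoticallyDiagonal S T (fun N i => u N i * v N i) (Q * R) := by
  obtain ⟨⟨C, hC, hC'⟩, hu⟩ := hu
  obtain ⟨⟨D, hD, hD'⟩, hv⟩ := hv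
  refine ⟨⟨C * D, by positivity, fun N i => norm_mul_le_of_le (hC' N i) (hD' N i)⟩, fun h => ?_⟩
  refine squeeze_zero (fun _ => norm_nonneg _) (fun N => ?_)
    (by simpa using ((hv h).const_mul C).add (hu (R h)))
  refine le_trans ?_ (add_le_add_left (norm_diagMul_le_of_le (hC' N) hC
    (diagMul (v N) (discreteModel S T N h) - discreteModel S T N (R h))) _)
  refine le_trans (le_of_eq ?_) (norm_add_le _ _)
  congr 1
  ext i
  simp only [diagMul, mul_apply_eq_comp, PiLp.sub_apply, PiLp.add_apply]
  module

theorem AsymptoticallyDiagonal.tendsto_norm (hS : Isometry S) (hT : Isometry T)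
    (hu : AsymptoticallyDiagonal S T u R) (h : H) :
    Tendsto (fun N => ‖diagMul (u N) (discreteModel S T N h)‖) atTop (𝓝 ‖R h‖) := by
  rw [tendsto_iff_norm_sub_tendsto_zero]
  refine squeeze_zero (fun _ => norm_nonneg _) (fun N => ?_) (hu.2 h)
  conv_lhs => rw [← norm_discreteModel hS hT N (R h)]
  exact abs_norm_sub_norm_le _ _

theorem AsymptoticallyDiagonal.norm_le (hS : Isometry S) (hT : Isometry T)
    (hu : AsymptoticallyDiagonal S T u Q) (hv : AsymptoticallyDiagonal S T v R) {M : ℝ}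
    (hM : 0 ≤ M) (h : ∀ N i, ‖u N i‖ ≤ M * ‖v N i‖) (x : H) : ‖Q x‖ ≤ M * ‖R x‖ :=
  le_of_tendsto_of_tendsto' (hu.tendsto_norm hS hT x) ((hv.tendsto_norm hS hT x).const_mul M)
    fun N => norm_diagMul_le (h N) hM _

end DiscreteModel

/-! ### The von Neumann inequality on the tetrablock -/

section VonNeumann

open MvPolynomial ContinuousLinearMap

variable {H : Type*} [NormedAddCommGroup H] [InnerProductSpace ℂ H] [CompleteSpace H]
variable {S T : H →L[ℂ] H}

/-- The model diagonalizes S and T, not their adjoints, with symbols z̄ and w̄. Taking the adjoint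
of the polynomial returns to S and T and conjugates its symbol. -/
theorem asymptoticallyDiagonal_star_polyEval (hS : Isometry S) (hT : Isometry T)
    (hST : Commute S T) (p : MvPolynomial (Fin 3) ℂ) :
    AsymptoticallyDiagonal S T (fun N i => star (eval ![rootOfUnity N i.1, rootOfUnity N i.2,
      rootOfUnity N i.1 * rootOfUnity N i.2] p))
      (star (polyEval p (star S) (star T) (star S * star T))) := by
  have hAB : Commute (star S) (star T) := hST.star_star
  obtain ⟨φ, hφ, h0, h1, h2⟩ := exists_algHom_polyEval hAB ((Commute.refl _).mul_right hAB)
    (hAB.symm.mul_right (Commute.refl _))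
  rw [← hφ]
  have hd0 := asymptoticallyDiagonal_fst hS hT hST
  have hd1 := asymptoticallyDiagonal_snd hS hT hST
  induction p using MvPolynomial.induction_on with
  | C c =>
    have : φ (C c) = c • 1 := by
      rw [← algebraMap_eq, AlgHom.commutes, Algebra.algebraMap_eq_smul_one]
    simpa [this, star_smul] using asymptoticallyDiagonal_const (S := S) (T := T) (star c)
  | add p q hp hq => simpa using hp.add hq
  | mul_X p i hp =>
    fin_cases i
    · simpa [h0, mul_comm] using hd0.mul hp
    · simpa [h1, mul_comm] using hd1.mul hp
    · have := (hd1.mul hd0).mul hp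
      simpa [h2, mul_comm, mul_left_comm, mul_assoc] using this

/-- For commuting isometries `S` and `T`, the triple `(S*, T*, S*T*)` has the closed tetrablock
as a spectral set. -/
theorem isTetrablockContraction_star (hS : Isometry S) (hT : Isometry T) (hST : Commute S T) :
    IsTetrablockContraction (star S) (star T) (star S * star T) := by
  have hAB : Commute (star S) (star T) := hST.star_star
  have hAC : Commute (star S) (star S * star T) := (Commute.refl _).mul_right hAB
  have hBC : Commute (star T) (star S * star T) := hAB.symm.mul_right (Commute.refl _)
  have hA : ‖star S‖ ≤ 1 := by rw [norm_star]; exact norm_le_one_of_isometry hS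
  have hB : ‖star T‖ ≤ 1 := by rw [norm_star]; exact norm_le_one_of_isometry hT
  have hunit : ∀ q : MvPolynomial (Fin 3) ℂ, (∀ x ∈ closure tetrablock, eval x q ≠ 0) →
      IsUnit (polyEval q (star S) (star T) (star S * star T)) := fun q hq => by
    refine isUnit_polyEval hAB hAC hBC q fun x y z hx hy hz => ?_
    rw [← hz rfl]
    exact hq _ (diagonal_mem_closure_tetrablock (hx.trans hA) (hy.trans hB))
  refine ⟨hAB, hAC, hBC, taylorSpectrum_mul_subset hAB hA hB, hunit, fun p q hq => ?_⟩
  set M := ⨆ x : closure tetrablock, ‖eval x.1 p / eval x.1 q‖ with hM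
  have hM0 : 0 ≤ M := Real.iSup_nonneg fun _ => norm_nonneg _
  have hle := (asymptoticallyDiagonal_star_polyEval hS hT hST p).norm_le hS hT
    (asymptoticallyDiagonal_star_polyEval hS hT hST q) hM0 fun N i => by
      rw [norm_star, norm_star]
      exact norm_eval_le_iSup p q hq (diagonal_mem_closure_tetrablock
        (norm_rootOfUnity N i.1).le (norm_rootOfUnity N i.2).le)
  have hcomm : Commute (polyEval p (star S) (star T) (star S * star T))
      (polyEval q (star S) (star T) (star S * star T)) := by
    obtain ⟨φ, hφ, -⟩ := exists_algHom_polyEval hAB hAC hBC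
    rw [← hφ, ← hφ]
    exact (Commute.all p q).map φ
  obtain ⟨w, hw⟩ := hunit q hq
  rw [← hw] at hle hcomm ⊢
  -- Passing to adjoints reduces the claim to ‖p* (q*)⁻¹x‖ ≤ M‖x‖, which is `hle` at (q*)⁻¹x.
  rw [Ring.inverse_unit, (hcomm.units_inv_right).eq, ← norm_star, star_mul]
  refine opNorm_le_bound _ hM0 fun x => ?_
  have h1 : star (w : H →L[ℂ] H) (star (↑w⁻¹ : H →L[ℂ] H) x) = x := by
    rw [← mul_apply_eq_comp, ← star_mul, Units.inv_mul, star_one, one_apply_eq_self]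
  have := hle (star (↑w⁻¹ : H →L[ℂ] H) x)
  rwa [h1] at this

end VonNeumann

/-! ### Defect spaces of adjoints of isometries -/

section Model

open ContinuousLinearMap

variable {H : Type*} [NormedAddCommGroup H] [InnerProductSpace ℂ H] [CompleteSpace H]

section Isometry

variable {V : H →L[ℂ] H}

theorem adjoint_apply_self_of_isometry (hV : Isometry V) (h : H) : adjoint V (V h) = h := by
  have h1 : adjoint V ∘L V = 1 :=
    (norm_map_iff_adjoint_comp_self V).mp ((AddMonoidHomClass.isometry_iff_norm V).mp hV)
  exact congrArg (fun L : H →L[ℂ] H => L h) h1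

theorem one_sub_adjoint_adjoint_mul_apply (V : H →L[ℂ] H) (h : H) :
    (1 - adjoint (adjoint V) * adjoint V : H →L[ℂ] H) h = h - V (adjoint V h) := by
  rw [adjoint_adjoint]; rfl

/-- 1 - VV* is the projection onto ker V*, so its range is already closed. -/
theorem mem_defectSpace_adjoint (hV : Isometry V) {h : H} :
    h ∈ defectSpace (adjoint V) ↔ adjoint V h = 0 := by
  constructor
  · intro hh
    have hcl : IsClosed ((LinearMap.ker (adjoint V).toLinearMap : Submodule ℂ H) : Set H) :=
      (adjoint V).isClosed_ker
    refine Submodule.topologicalClosure_minimal _ ?_ hcl hh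
    rintro _ ⟨x, rfl⟩
    change adjoint V ((1 - adjoint (adjoint V) * adjoint V : H →L[ℂ] H) x) = 0
    rw [one_sub_adjoint_adjoint_mul_apply, map_sub, adjoint_apply_self_of_isometry hV, sub_self]
  · intro hh
    refine Submodule.le_topologicalClosure _ ⟨h, ?_⟩
    change (1 - adjoint (adjoint V) * adjoint V : H →L[ℂ] H) h = h
    rw [one_sub_adjoint_adjoint_mul_apply, hh, map_zero, sub_zero]

theorem isStarProjection_one_sub_self_mul_adjoint (hV : Isometry V) :
    IsStarProjection (1 - V * adjoint V) := by
  refine IsStarProjection.one_sub ⟨?_, ?_⟩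
  · ext h
    exact congrArg V (adjoint_apply_self_of_isometry hV _)
  · change star (V * star V) = V * star V
    rw [star_mul, star_star]

theorem defectOp_adjoint (hV : Isometry V) : defectOp (adjoint V) = 1 - V * adjoint V := by
  have hp := isStarProjection_one_sub_self_mul_adjoint hV
  rw [defectOp, adjoint_adjoint]
  exact CFC.sqrt_unique hp.isIdempotentElem.eq hp.nonneg

theorem coe_defectMap_adjoint (hV : Isometry V) (h : H) :
    (defectMap (adjoint V) h : H) = h - V (adjoint V h) := by
  change defectOp (adjoint V) h = _
  rw [defectOp_adjoint hV]
  rfl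

theorem defectMap_adjoint_apply_self (hV : Isometry V) (h : H) :
    defectMap (adjoint V) (V h) = 0 := by
  refine Subtype.ext ?_
  rw [coe_defectMap_adjoint hV, adjoint_apply_self_of_isometry hV, sub_self]
  rfl

theorem adjoint_apply_coe_defectSpace (hV : Isometry V) (k : defectSpace (adjoint V)) :
    adjoint V k = 0 :=
  (mem_defectSpace_adjoint hV).mp k.2

theorem defectMap_adjoint_coe (hV : Isometry V) (k : defectSpace (adjoint V)) :
    defectMap (adjoint V) k = k := by
  refine Subtype.ext ?_
  rw [coe_defectMap_adjoint hV, adjoint_apply_coe_defectSpace hV, map_zero, sub_zero]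

theorem inner_defectMap_adjoint (hV : Isometry V) (h : H) (k : defectSpace (adjoint V)) :
    inner ℂ (defectMap (adjoint V) h) k = inner ℂ h (k : H) := by
  rw [Submodule.coe_inner, coe_defectMap_adjoint hV, inner_sub_left, ← adjoint_inner_right,
    adjoint_apply_coe_defectSpace hV, inner_zero_right, sub_zero]

/-- The fundamental equations of a coisometry have at most one solution. -/
theorem defectSpace_sandwich_injective (hV : Isometry V)
    {F G : defectSpace (adjoint V) →L[ℂ] defectSpace (adjoint V)}
    (h : defectOp (adjoint V) ∘L (defectSpace (adjoint V)).subtypeL ∘L F ∘L defectMap (adjoint V) =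
      defectOp (adjoint V) ∘L (defectSpace (adjoint V)).subtypeL ∘L G ∘L defectMap (adjoint V)) :
    F = G := by
  ext k
  have h1 := congrArg (fun L : H →L[ℂ] H => L k) h
  change (defectMap (adjoint V) (F (defectMap (adjoint V) k)) : H) =
    defectMap (adjoint V) (G (defectMap (adjoint V) k)) at h1
  simpa only [defectMap_adjoint_coe hV] using h1

end Isometry

section Compression

variable {V : H →L[ℂ] H}

/-- The compression of an operator to the defect space of `V*`. -/
noncomputable def compress (V R : H →L[ℂ] H) :
    defectSpace (adjoint V) →L[ℂ] defectSpace (adjoint V) :=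
  defectMap (adjoint V) ∘L R ∘L (defectSpace (adjoint V)).subtypeL

theorem coe_compress (hV : Isometry V) (R : H →L[ℂ] H) (k : defectSpace (adjoint V)) :
    (compress V R k : H) = R k - V (adjoint V (R k)) :=
  coe_defectMap_adjoint hV _

theorem adjoint_compress (hV : Isometry V) (R : H →L[ℂ] H) :
    adjoint (compress V R) = compress V (adjoint R) := by
  symm
  rw [eq_adjoint_iff]
  intro k l
  change inner ℂ (defectMap (adjoint V) (adjoint R k)) l =
    inner ℂ k (defectMap (adjoint V) (R l))
  rw [inner_defectMap_adjoint hV, ← inner_conj_symm k, inner_defectMap_adjoint hV, inner_conj_symm,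
    adjoint_inner_left]

end Compression

/-! ### The unitary and the projection of a factorization V = ST -/

section Factorization

variable {S T V : H →L[ℂ] H}

theorem adjoint_factor_comm (hST : S * T = V) (hTS : T * S = V) (h : H) :
    adjoint S (adjoint T h) = adjoint V h ∧ adjoint T (adjoint S h) = adjoint V h := by
  constructor
  · rw [← hTS]; exact (congrArg (fun L : H →L[ℂ] H => L h) (star_mul T S)).symm
  · rw [← hST]; exact (congrArg (fun L : H →L[ℂ] H => L h) (star_mul S T)).symm

/-- The unitary `S(1 - TT*) + T*` on the defect space of `(ST)*`. -/
noncomputable def bclUnitary (S T V : H →L[ℂ] H) :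
    defectSpace (adjoint V) →L[ℂ] defectSpace (adjoint V) :=
  compress V (S * (1 - T * adjoint T) + adjoint T)

/-- The projection onto the kernel of `S*` on the defect space of `(ST)*`. -/
noncomputable def bclProjection (S V : H →L[ℂ] H) :
    defectSpace (adjoint V) →L[ℂ] defectSpace (adjoint V) :=
  compress V (1 - S * adjoint S)

variable (hS : Isometry S) (hT : Isometry T) (hV : Isometry V) (hST : S * T = V) (hTS : T * S = V)
include hS hT hV hST hTS

/-- S(1 - TT*) + T* maps ker V* into itself, so the compression is a plain restriction. -/
theorem coe_bclUnitary (k : defectSpace (adjoint V)) :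
    (bclUnitary S T V k : H) = S k - S (T (adjoint T k)) + adjoint T k := by
  have hk := adjoint_apply_coe_defectSpace hV k
  have e : ∀ h, adjoint V h = adjoint T (adjoint S h) :=
    fun h => (adjoint_factor_comm hST hTS h).2.symm
  have e1 : adjoint V (adjoint T k) = 0 := by
    rw [e, (adjoint_factor_comm hST hTS _).1, hk, map_zero]
  rw [bclUnitary, coe_compress hV]
  change S ((k : H) - T (adjoint T k)) + adjoint T k -
    V (adjoint V (S ((k : H) - T (adjoint T k)) + adjoint T k)) = _
  rw [map_add (adjoint V), e1, e, adjoint_apply_self_of_isometry hS, map_sub (adjoint T),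
    adjoint_apply_self_of_isometry hT, sub_self, add_zero, map_zero, sub_zero, map_sub]

omit hS in
theorem coe_adjoint_bclUnitary (k : defectSpace (adjoint V)) :
    (adjoint (bclUnitary S T V) k : H) = adjoint S k + T k - T (S (adjoint S k)) := by
  have hk := adjoint_apply_coe_defectSpace hV k
  have e2 := adjoint_factor_comm hST hTS
  have h1 : adjoint (S * (1 - T * adjoint T) + adjoint T) =
      (1 - T * adjoint T) * adjoint S + T := by
    change star (S * (1 - T * star T) + star T) = (1 - T * star T) * star S + T
    simp [star_mul]
  rw [bclUnitary, adjoint_compress hV, h1, coe_compress hV]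
  change adjoint S k - T (adjoint T (adjoint S k)) + T k -
    V (adjoint V (adjoint S k - T (adjoint T (adjoint S k)) + T k)) = _
  rw [(e2 _).2, hk, map_zero, sub_zero, map_add (adjoint V), ← (e2 (adjoint S k)).1, (e2 _).2, hk,
    map_zero, zero_add, ← (e2 (T k)).1, adjoint_apply_self_of_isometry hT]
  exact congrArg (fun L : H →L[ℂ] H => adjoint S (k : H) + T k - L (adjoint S k)) hTS.symm

omit hT in
theorem coe_bclProjection (k : defectSpace (adjoint V)) :
    (bclProjection S V k : H) = k - S (adjoint S k) := by
  have hk := adjoint_apply_coe_defectSpace hV k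
  rw [bclProjection, coe_compress hV]
  change k - S (adjoint S k) - V (adjoint V (k - S (adjoint S k))) = _
  rw [← (adjoint_factor_comm hST hTS _).2, map_sub (adjoint S), adjoint_apply_self_of_isometry hS,
    sub_self, map_zero, map_zero, sub_zero]

/-- S maps ker T* onto S ker T* and T* maps T ker S* onto ker S*, both isometrically; these pairs of
subspaces are the two orthogonal splittings of ker V*. -/
theorem bclUnitary_mem_unitary : bclUnitary S T V ∈ unitary _ := by
  have e2 := adjoint_factor_comm hST hTS
  have hk := adjoint_apply_coe_defectSpace hV
  rw [Unitary.mem_iff]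
  constructor <;> ext k
  · change (adjoint (bclUnitary S T V) (bclUnitary S T V k) : H) = k
    rw [coe_adjoint_bclUnitary hT hV hST hTS, coe_bclUnitary hS hT hV hST hTS]
    simp only [map_add, map_sub, adjoint_apply_self_of_isometry hS, (e2 _).1, hk, map_zero]
    abel
  · change (bclUnitary S T V (adjoint (bclUnitary S T V) k) : H) = k
    rw [coe_bclUnitary hS hT hV hST hTS, coe_adjoint_bclUnitary hT hV hST hTS]
    simp only [map_add, map_sub, adjoint_apply_self_of_isometry hT, (e2 _).2, hk, map_zero]
    abel

omit hT in
theorem isStarProjection_bclProjection : IsStarProjection (bclProjection S V) := by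
  refine ⟨?_, ?_⟩
  · ext k
    change (bclProjection S V (bclProjection S V k) : H) = bclProjection S V k
    rw [coe_bclProjection hS hV hST hTS (bclProjection S V k), coe_bclProjection hS hV hST hTS]
    simp only [map_sub, adjoint_apply_self_of_isometry hS, sub_self, map_zero, sub_zero]
  · change adjoint (bclProjection S V) = bclProjection S V
    rw [bclProjection, adjoint_compress hV]
    congr 1
    change star (1 - S * star S) = 1 - S * star S
    simp [star_mul]

theorem coe_star_bclUnitary_mul (k : defectSpace (adjoint V)) :
    ((star (bclUnitary S T V) * (1 - bclProjection S V)) k : H) = adjoint S k := by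
  change (adjoint (bclUnitary S T V) (k - bclProjection S V k) : H) = _
  rw [coe_adjoint_bclUnitary hT hV hST hTS, Submodule.coe_sub,
    coe_bclProjection hS hV hST hTS]
  simp only [map_sub, adjoint_apply_self_of_isometry hS, sub_self, sub_zero]
  abel

theorem coe_bclProjection_mul (k : defectSpace (adjoint V)) :
    ((bclProjection S V * bclUnitary S T V) k : H) = adjoint T k := by
  change (bclProjection S V (bclUnitary S T V k) : H) = _
  rw [coe_bclProjection hS hV hST hTS, coe_bclUnitary hS hT hV hST hTS]
  simp only [map_add, map_sub, adjoint_apply_self_of_isometry hS,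
    (adjoint_factor_comm hST hTS _).1, adjoint_apply_coe_defectSpace hV, map_zero]
  abel

theorem coe_one_sub_bclProjection_mul (k : defectSpace (adjoint V)) :
    (((1 - bclProjection S V) * bclUnitary S T V) k : H) = S k - S (T (adjoint T k)) := by
  rw [sub_mul, one_mul]
  change (bclUnitary S T V k : H) - ((bclProjection S V * bclUnitary S T V) k : H) = _
  rw [coe_bclProjection_mul hS hT hV hST hTS, coe_bclUnitary hS hT hV hST hTS]
  abel

theorem defectMap_factor_apply (h : H) :
    defectMap (adjoint V) (S h) =
      ((1 - bclProjection S V) * bclUnitary S T V) (defectMap (adjoint V) h) := by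
  refine Subtype.ext ?_
  rw [coe_one_sub_bclProjection_mul hS hT hV hST hTS, coe_defectMap_adjoint hV,
    coe_defectMap_adjoint hV, ← (adjoint_factor_comm hST hTS (S h)).2,
    adjoint_apply_self_of_isometry hS]
  have h1 : ∀ x, adjoint T (V x) = S x := fun x => by
    rw [← hTS]; exact adjoint_apply_self_of_isometry hT _
  have h2 : ∀ x, S (T x) = V x := fun x => by rw [← hST]; rfl
  have h3 : ∀ x, S (V x) = V (S x) := fun x => by rw [← h2 (S x), ← hTS]; rfl
  simp only [map_sub, h1, h2, h3]
  abel

/-- Split h = (1 - VV*)h + VV*h and apply T*: the first part stays in ker V*, where T* is PU; the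
second becomes SV*h because T*V = S. -/
theorem defectMap_adjoint_factor_apply (h : H) :
    defectMap (adjoint V) (adjoint T h) =
      ((1 - bclProjection S V) * bclUnitary S T V) (defectMap (adjoint V) (adjoint V h)) +
      (bclProjection S V * bclUnitary S T V) (defectMap (adjoint V) h) := by
  rw [← defectMap_factor_apply hS hT hV hST hTS]
  refine Subtype.ext ?_
  rw [Submodule.coe_add, coe_bclProjection_mul hS hT hV hST hTS]
  simp only [coe_defectMap_adjoint hV, map_sub]
  have h1 : adjoint T (V (adjoint V h)) = S (adjoint V h) := by
    rw [← hTS]; exact adjoint_apply_self_of_isometry hT _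
  have h2 : adjoint V (S (adjoint V h)) = adjoint V (adjoint T h) := by
    rw [← (adjoint_factor_comm hST hTS _).2, adjoint_apply_self_of_isometry hS,
      ← (adjoint_factor_comm hST hTS (adjoint T h)).2, (adjoint_factor_comm hST hTS h).1]
  rw [h1, h2]
  abel

/-- From S*V = T and T*V = S, the left sides are S*(1 - VV*) and T*(1 - VV*); ker V* is invariant
under S* and T*, so the outer defect operator acts as the identity. -/
theorem fundamentalEquations_bcl :
    FundamentalEquations (adjoint S) (adjoint T) (adjoint V)
      (star (bclUnitary S T V) * (1 - bclProjection S V))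
      (bclProjection S V * bclUnitary S T V) := by
  have e2 := adjoint_factor_comm hST hTS
  constructor <;> ext h
  · change adjoint S h - adjoint (adjoint T) (adjoint V h) = (defectMap (adjoint V)
      ((star (bclUnitary S T V) * (1 - bclProjection S V)) (defectMap (adjoint V) h) :
        defectSpace (adjoint V)) : H)
    rw [defectMap_adjoint_coe hV, coe_star_bclUnitary_mul hS hT hV hST hTS,
      coe_defectMap_adjoint hV, adjoint_adjoint, map_sub, ← hST]
    exact congrArg _ (adjoint_apply_self_of_isometry hS _).symm
  · change adjoint T h - adjoint (adjoint S) (adjoint V h) = (defectMap (adjoint V)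
      ((bclProjection S V * bclUnitary S T V) (defectMap (adjoint V) h) :
        defectSpace (adjoint V)) : H)
    rw [defectMap_adjoint_coe hV, coe_bclProjection_mul hS hT hV hST hTS,
      coe_defectMap_adjoint hV, adjoint_adjoint, map_sub, ← hTS]
    exact congrArg _ (adjoint_apply_self_of_isometry hT _).symm

theorem areFundamentalOperators_bcl :
    AreFundamentalOperators (adjoint S) (adjoint T) (adjoint V)
      (star (bclUnitary S T V) * (1 - bclProjection S V))
      (bclProjection S V * bclUnitary S T V) := by
  have he := fundamentalEquations_bcl hS hT hV hST hTS
  refine ⟨?_, he, fun G₁ G₂ hG => ⟨?_, ?_⟩⟩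
  · have h1 := isTetrablockContraction_star hS hT (hST.trans hTS.symm)
    rwa [← star_mul, hTS] at h1
  · exact defectSpace_sandwich_injective hV (hG.1.symm.trans he.1)
  · exact defectSpace_sandwich_injective hV (hG.2.symm.trans he.2)

end Factorization

/-! ### The Wold decomposition and Toeplitz symbols -/

section Wold

variable {V : H →L[ℂ] H}

/-- The `k`-th power of an isometry, restricted to the defect space of its adjoint. -/
noncomputable def wanderingIsometry (hV : Isometry V) (k : ℕ) :
    defectSpace (adjoint V) →ₗᵢ[ℂ] H where
  toLinearMap := ((V ^ k) ∘L (defectSpace (adjoint V)).subtypeL).toLinearMap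
  norm_map' x := norm_pow_apply_of_isometry hV k x

theorem wanderingIsometry_apply (hV : Isometry V) (k : ℕ) (x : defectSpace (adjoint V)) :
    wanderingIsometry hV k x = (V ^ k) x := rfl

theorem adjoint_pow_apply_pow (hV : Isometry V) (k : ℕ) (h : H) :
    (adjoint V ^ k) ((V ^ k) h) = h := by
  induction k with
  | zero => simp
  | succ k ih =>
    rw [pow_succ, pow_succ', mul_apply_eq_comp, mul_apply_eq_comp,
      adjoint_apply_self_of_isometry hV, ih]

theorem defectMap_adjoint_pow_wandering (hV : Isometry V) (k i : ℕ)
    (x : defectSpace (adjoint V)) :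
    defectMap (adjoint V) ((adjoint V ^ k) (wanderingIsometry hV i x)) = if i = k then x else 0 := by
  rw [wanderingIsometry_apply]
  rcases lt_trichotomy i k with h | rfl | h
  · obtain ⟨d, rfl⟩ := Nat.exists_eq_add_of_lt h
    rw [if_neg (by omega), add_assoc, add_comm, pow_add, mul_apply_eq_comp,
      adjoint_pow_apply_pow hV, pow_succ, mul_apply_eq_comp, adjoint_apply_coe_defectSpace hV,
      map_zero, map_zero]
  · rw [if_pos rfl, adjoint_pow_apply_pow hV, defectMap_adjoint_coe hV]
  · obtain ⟨d, rfl⟩ := Nat.exists_eq_add_of_lt h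
    rw [if_neg (by omega), add_assoc, pow_add, mul_apply_eq_comp, adjoint_pow_apply_pow hV,
      pow_succ', mul_apply_eq_comp, defectMap_adjoint_apply_self hV]

theorem orthogonalFamily_wandering (hV : Isometry V) :
    OrthogonalFamily ℂ (fun _ : ℕ => defectSpace (adjoint V)) (wanderingIsometry hV) := by
  have key : ∀ i j, i < j → ∀ x y,
      inner ℂ (wanderingIsometry hV i x) (wanderingIsometry hV j y) = 0 := by
    intro i j hij x y
    obtain ⟨d, rfl⟩ := Nat.exists_eq_add_of_lt hij
    let W : H →ₗᵢ[ℂ] H := ⟨(V ^ i).toLinearMap, norm_pow_apply_of_isometry hV i⟩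
    have h1 : wanderingIsometry hV (i + d + 1) y = W (V ((V ^ d) y)) := by
      rw [wanderingIsometry_apply, add_assoc, pow_add, pow_succ']; rfl
    have h2 : wanderingIsometry hV i x = W x := rfl
    rw [h1, h2, W.inner_map_map, ← adjoint_inner_left, adjoint_apply_coe_defectSpace hV,
      inner_zero_left]
  intro i j hij x y
  rcases lt_or_gt_of_ne hij with h | h
  · exact key i j h x y
  · rw [← inner_conj_symm, key j i h y x, map_zero]

/-- Telescoping: VᴺV*ᴺ - Vᴺ⁺¹V*ᴺ⁺¹ = Vᴺ(1 - VV*)V*ᴺ has range in the N-th wandering summand. -/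
theorem sub_pow_adjoint_pow_mem (hV : Isometry V) (N : ℕ) (h : H) :
    h - (V ^ N) ((adjoint V ^ N) h) ∈
      ⨆ i, LinearMap.range (wanderingIsometry hV i).toLinearMap := by
  induction N with
  | zero => simp
  | succ N ih =>
    have h1 : h - (V ^ (N + 1)) ((adjoint V ^ (N + 1)) h) = (h - (V ^ N) ((adjoint V ^ N) h)) +
        wanderingIsometry hV N (defectMap (adjoint V) ((adjoint V ^ N) h)) := by
      rw [wanderingIsometry_apply, coe_defectMap_adjoint hV, map_sub, pow_succ V,
        pow_succ' (adjoint V)]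
      simp only [mul_apply_eq_comp]
      abel
    rw [h1]
    exact add_mem ih (Submodule.mem_iSup_of_mem N ⟨_, rfl⟩)

/-- Purity makes the remainder VᴺV*ᴺh tend to 0, as its norm is ‖V*ᴺh‖; hence the summands are
total. -/
theorem isHilbertSum_wandering (hV : Isometry V) (hpure : IsPure V) :
    IsHilbertSum ℂ (fun _ : ℕ => defectSpace (adjoint V)) (wanderingIsometry hV) := by
  refine IsHilbertSum.mk (orthogonalFamily_wandering hV) fun h _ => ?_
  refine mem_closure_of_tendsto (f := fun N : ℕ => h - (V ^ N) ((adjoint V ^ N) h)) (b := atTop)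
    ?_ (Eventually.of_forall fun N => sub_pow_adjoint_pow_mem hV N h)
  have h1 : Tendsto (fun N : ℕ => (V ^ N) ((adjoint V ^ N) h)) atTop (𝓝 0) := by
    rw [tendsto_zero_iff_norm_tendsto_zero]
    simpa only [norm_pow_apply_of_isometry hV, norm_zero] using (hpure h).norm
  simpa using tendsto_const_nhds.sub h1

/-- The Taylor coefficients, as an isometry of `H²(E)` onto the square-summable sequences. -/
noncomputable def HardySpace.taylorIsometry (E : Type*) [NormedAddCommGroup E]
    [InnerProductSpace ℂ E] [CompleteSpace E] : HardySpace E ≃ₗᵢ[ℂ] lp (fun _ : ℕ => E) 2 :=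
  ⟨HardySpace.taylor E, fun _ => rfl⟩

/-- The Wold representation of a pure isometry on the Hardy space of its wandering subspace. -/
noncomputable def woldEquiv (hV : Isometry V) (hpure : IsPure V) :
    H ≃ₗᵢ[ℂ] HardySpace (defectSpace (adjoint V)) :=
  (isHilbertSum_wandering hV hpure).linearIsometryEquiv.trans
    (HardySpace.taylorIsometry _).symm

/-- (1 - VV*)V*ᵏ kills every summand VⁱKer V* with i ≠ k and recovers x from Vᵏx, so it reads off
the k-th coefficient of the orthogonal expansion. -/
theorem taylor_woldEquiv (hV : Isometry V) (hpure : IsPure V) (h : H) (k : ℕ) :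
    HardySpace.taylor _ (woldEquiv hV hpure h) k =
      defectMap (adjoint V) ((adjoint V ^ k) h) := by
  set a := (isHilbertSum_wandering hV hpure).linearIsometryEquiv h with ha
  have h1 : HardySpace.taylor _ (woldEquiv hV hpure h) = a :=
    (HardySpace.taylorIsometry _).apply_symm_apply a
  have h2 := (isHilbertSum_wandering hV hpure).hasSum_linearIsometryEquiv_symm a
  rw [ha, LinearIsometryEquiv.symm_apply_apply, ← ha] at h2
  have h3 := h2.mapL (defectMap (adjoint V) ∘L (adjoint V ^ k))
  simp only [ContinuousLinearMap.comp_apply, defectMap_adjoint_pow_wandering hV] at h3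
  rw [h1]
  refine HasSum.unique ?_ h3
  convert hasSum_single (f := fun i => if i = k then a i else 0) k (fun i hi => if_neg hi)
  simp

omit [CompleteSpace H] in
/-- An operator whose action on Taylor coefficients is convolution with `(A, B)` is the Toeplitz
operator with symbol `A + zB`. -/
theorem intertwinesToeplitz_of_taylor {E : Type*} [NormedAddCommGroup E] [InnerProductSpace ℂ E]
    [CompleteSpace E] (W : H ≃ₗᵢ[ℂ] HardySpace E) (R : H →L[ℂ] H) (A B : E →L[ℂ] E)
    (c : H → ℕ → E) (hc : ∀ h k, HardySpace.taylor E (W h) k = c h k)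
    (φ : ℂ → E →L[ℂ] E) (hφ : ∀ z x, φ z x = A x + z • B x)
    (h0 : ∀ h, c (R h) 0 = A (c h 0))
    (h1 : ∀ h k, c (R h) (k + 1) = A (c h (k + 1)) + B (c h k)) :
    IntertwinesToeplitz W R φ := by
  intro f z
  obtain ⟨h, rfl⟩ := W.surjective f
  change W (R (W.symm (W h))) z = _
  rw [W.symm_apply_apply]
  have hf := HardySpace.hasSum_taylor (W h) z
  have hR := HardySpace.hasSum_taylor (W (R h)) z
  simp only [hc] at hf hR
  have hA := hf.mapL A
  have hB := (hf.mapL B).const_smul (z : ℂ)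
  rw [← hasSum_nat_add_iff' 1] at hA hR
  rw [Finset.sum_range_one] at hA hR
  have hsum := hA.add hB
  have hterm : (fun k : ℕ => A ((z : ℂ) ^ (k + 1) • c h (k + 1)) +
      (z : ℂ) • B ((z : ℂ) ^ k • c h k)) = fun k : ℕ => (z : ℂ) ^ (k + 1) • c (R h) (k + 1) := by
    funext k
    rw [h1, smul_add, map_smul, map_smul, smul_smul, pow_succ']
  rw [hterm] at hsum
  have := hR.unique hsum
  rw [h0, pow_zero, one_smul, one_smul] at this
  rw [hφ]
  linear_combination (norm := module) this

theorem woldEquiv_intertwines_self (hV : Isometry V) (hpure : IsPure V) :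
    IntertwinesToeplitz (woldEquiv hV hpure) V (fun z => z • 1) := by
  refine intertwinesToeplitz_of_taylor (woldEquiv hV hpure) V 0 1
    (fun h k => defectMap (adjoint V) ((adjoint V ^ k) h)) (taylor_woldEquiv hV hpure) _
    (fun z x => (zero_add _).symm) (fun h => ?_) (fun h k => ?_)
  · exact defectMap_adjoint_apply_self hV h
  · rw [pow_succ, mul_apply_eq_comp, adjoint_apply_self_of_isometry hV]
    exact (zero_add _).symm

theorem woldEquiv_intertwines_factor {S T : H →L[ℂ] H} (hS : Isometry S) (hT : Isometry T)
    (hV : Isometry V) (hST : S * T = V) (hTS : T * S = V) (hpure : IsPure V) :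
    IntertwinesToeplitz (woldEquiv hV hpure) S (fun z => (1 - bclProjection S V) *
      bclUnitary S T V + z • (bclProjection S V * bclUnitary S T V)) := by
  refine intertwinesToeplitz_of_taylor (woldEquiv hV hpure) S
    ((1 - bclProjection S V) * bclUnitary S T V) (bclProjection S V * bclUnitary S T V)
    (fun h k => defectMap (adjoint V) ((adjoint V ^ k) h)) (taylor_woldEquiv hV hpure) _
    (fun z x => rfl) (fun h => ?_) (fun h k => ?_)
  · exact defectMap_factor_apply hS hT hV hST hTS h
  · have hc : Commute (adjoint V ^ k) (adjoint T) := by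
      refine Commute.pow_left ?_ k
      have : Commute V T := by
        change V * T = T * V
        nth_rewrite 1 [← hTS]
        rw [mul_assoc, hST]
      exact this.star_star
    -- One factor V* absorbs S through V*S = T*, which lowers the exponent and produces the shift by
    -- z.
    have h1 : (adjoint V ^ (k + 1)) (S h) = adjoint T ((adjoint V ^ k) h) := by
      rw [pow_succ, mul_apply_eq_comp, ← (adjoint_factor_comm hST hTS (S h)).2,
        adjoint_apply_self_of_isometry hS]
      exact congrArg (fun L : H →L[ℂ] H => L h) hc.eq
    rw [h1, defectMap_adjoint_factor_apply hS hT hV hST hTS, pow_succ']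
    rfl

end Wold

omit [CompleteSpace H] in
theorem isometry_noncommProd {ι : Type*} (s : Finset ι) (V : ι → H →L[ℂ] H)
    (hcomm : (s : Set ι).Pairwise (Function.onFun Commute V)) (hisom : ∀ i, Isometry (V i)) :
    Isometry (s.noncommProd V hcomm : H →L[ℂ] H) :=
  Finset.noncommProd_induction s V hcomm (fun L => Isometry L) (fun _ _ ha hb => ha.comp hb)
    isometry_id fun i _ => hisom i

end Model

end TetrablockBCL

theorem theorem3 {H : Type*} [NormedAddCommGroup H] [InnerProductSpace ℂ H] [CompleteSpace H]
    (n : ℕ) (V : Fin n → H →L[ℂ] H)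
    (hcomm : ∀ i j, Commute (V i) (V j))
    (hisom : ∀ i, Isometry (V i))
    (Vprod : H →L[ℂ] H)
    (hVprod : Vprod = Finset.univ.noncommProd V (fun i _ j _ _ => hcomm i j))
    (hpure : TetrablockBCL.IsPure Vprod) :
    ∃ P U : Fin n → (TetrablockBCL.defectSpace (ContinuousLinearMap.adjoint Vprod) →L[ℂ]
        TetrablockBCL.defectSpace (ContinuousLinearMap.adjoint Vprod)),
      (∀ i, IsStarProjection (P i)) ∧
      (∀ i, U i ∈ unitary (TetrablockBCL.defectSpace (ContinuousLinearMap.adjoint Vprod) →L[ℂ]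
        TetrablockBCL.defectSpace (ContinuousLinearMap.adjoint Vprod))) ∧
      (∃ W : H ≃ₗᵢ[ℂ] TetrablockBCL.HardySpace
          (TetrablockBCL.defectSpace (ContinuousLinearMap.adjoint Vprod)),
        (∀ i, TetrablockBCL.IntertwinesToeplitz W (V i)
          (fun z => (1 - P i) * U i + z • (P i * U i))) ∧
        TetrablockBCL.IntertwinesToeplitz W Vprod (fun z => z • 1)) ∧
      (∀ i, TetrablockBCL.AreFundamentalOperators
        (ContinuousLinearMap.adjoint (V i))
        (ContinuousLinearMap.adjoint
          ((Finset.univ.erase i).noncommProd V (fun j _ k _ _ => hcomm j k)))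
        (ContinuousLinearMap.adjoint Vprod)
        (star (U i) * (1 - P i)) (P i * U i)) := by
  have hV : Isometry Vprod := hVprod ▸ TetrablockBCL.isometry_noncommProd _ _ _ hisom
  let T : Fin n → H →L[ℂ] H := fun i =>
    (Finset.univ.erase i).noncommProd V (fun j _ k _ _ => hcomm j k)
  have hT : ∀ i, Isometry (T i) := fun i => TetrablockBCL.isometry_noncommProd _ _ _ hisom
  have hST : ∀ i, V i * T i = Vprod := fun i => by
    rw [hVprod]
    exact Finset.mul_noncommProd_erase Finset.univ (Finset.mem_univ i) V _
  have hTS : ∀ i, T i * V i = Vprod := fun i => by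
    rw [hVprod]
    exact Finset.noncommProd_erase_mul Finset.univ (Finset.mem_univ i) V _
  exact ⟨fun i => TetrablockBCL.bclProjection (V i) Vprod,
    fun i => TetrablockBCL.bclUnitary (V i) (T i) Vprod,
    fun i => TetrablockBCL.isStarProjection_bclProjection (hisom i) hV (hST i) (hTS i),
    fun i => TetrablockBCL.bclUnitary_mem_unitary (hisom i) (hT i) hV (hST i) (hTS i),
    -- The Wold unitary depends on `Vprod` alone, so the same one serves every i.
    ⟨TetrablockBCL.woldEquiv hV hpure,
      fun i => TetrablockBCL.woldEquiv_intertwines_factor (hisom i) (hT i) hV (hST i) (hTS i) hpure,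
      TetrablockBCL.woldEquiv_intertwines_self hV hpure⟩,
    fun i => TetrablockBCL.areFundamentalOperators_bcl (hisom i) (hT i) hV (hST i) (hTS i)⟩
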